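/- Let $\lambda_0>0$, $v\ge 0$ and $t\ge 0$. Consider two networks. (1) Terrestrial network: static base stations, at some fixed height above the ground, whose ground projections $x_1,x_2,\dots$ are the points (in an arbitrary enumeration) of a homogeneous Poisson point process of density $\lambda_0$ on $\mathbb{R}^2$. A reference user (UE) on the ground starts at a given point and moves along a straight line at constant speed $v$, in a direction that is independent of the base stations (deterministic, or random with any law, for instance uniform). (2) Aerial network (same speed model): drone base stations, at some fixed height above the ground, whose ground projections are initially the points of a homogeneous Poisson point process of density $\lambda_0$ on $\mathbb{R}^2$. Each moves horizontally along a straight line at the same constant speed $v$, in a direction uniform on $[0,2\pi)$; the directions are independent of each other and of the initial positions. The UE is static at a given point of the ground. In each network, let $d_i(s)$ be the distance from the UE to the $i$-th base station at time $s$. The UE is served by its nearest base station, and the event of a handover until time $t$ is $$H(t)=\Bigl\{\exists\, s\in[0,t):\ \operatorname*{arg\,min}_{i} d_i(s)\neq \operatorname*{arg\,min}_{i} d_i(t)\Bigr\},$$ where $\operatorname{arg\,min}$ denotes the set of minimizing indices. Then in both networks $H(t)$ is an event (measurable up to a null set), and the handover probability $\mathbb{P}[H(t)]$ is the same in the two networks.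 -/

import Mathlib

open MeasureTheory ProbabilityTheory
open scoped NNReal ENNReal

namespace Handover

/-- The plane in which the base stations live (and, for the ground, in which the UE moves). -/
abbrev Plane := EuclideanSpace ℝ (Fin 2)

/-- Three-dimensional space. -/
abbrev Space := EuclideanSpace ℝ (Fin 3)

/-- The point of space at height `h` above the point `x` of the ground plane. -/
noncomputable def atHeight (h : ℝ) (x : Plane) : Space := !₂[x 0, x 1, h]

/-- The unit vector that makes the angle `θ` with the positive `x`-axis. -/
noncomputable def direction (θ : ℝ) : Plane := !₂[Real.cos θ, Real.sin θ]

/-- Position at time `s` of an object that starts at `x` and moves along a straight line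
in direction `θ` at constant speed `v`. -/
noncomputable def move (v : ℝ) (x : Plane) (θ s : ℝ) : Plane := x + (v * s) • direction θ

section PointProcess

variable {Ω E : Type*}

/-- Number of points of the random family `X` that lie in `B`, counted with multiplicity. -/
noncomputable def numPoints (X : ℕ → Ω → E) (B : Set E) (ω : Ω) : ℕ∞ :=
  {i : ℕ | X i ω ∈ B}.encard

/-- The random points `X 0, X 1, …` are an (arbitrary) enumeration of the points of a Poisson
point process with intensity measure `Λ`: counts in sets of finite intensity are Poisson,
and counts in pairwise disjoint sets are independent. -/
structure IsPoissonProcess [MeasurableSpace Ω] [MeasurableSpace E]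
    (X : ℕ → Ω → E) (Λ : Measure E) (P : Measure Ω) : Prop where
  measurable : ∀ i, Measurable (X i)
  count_law : ∀ B : Set E, MeasurableSet B → Λ B ≠ ∞ →
    HasLaw (numPoints X B) ((poissonMeasure (Λ B).toNNReal).map (fun n : ℕ => (n : ℕ∞))) P
  count_indep : ∀ (k : ℕ) (B : Fin k → Set E), (∀ j, MeasurableSet (B j)) →
    Pairwise (fun j l => Disjoint (B j) (B l)) →
    iIndepFun (fun j => numPoints X (B j)) P

/-- The random points `X 0, X 1, …` enumerate a homogeneous Poisson point process of density `lam`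
in the plane. -/
def IsHomogeneousPPP [MeasurableSpace Ω] (X : ℕ → Ω → Plane) (lam : ℝ≥0) (P : Measure Ω) : Prop :=
  IsPoissonProcess X (lam • (volume : Measure Plane)) P

/-- The angles `Θ 0, Θ 1, …` are i.i.d. uniform on `[0, 2π)` and independent of the points `X`. -/
structure IsIIDUniformDirections [MeasurableSpace Ω]
    (Θ : ℕ → Ω → ℝ) (X : ℕ → Ω → Plane) (P : Measure Ω) : Prop where
  measurable : ∀ i, Measurable (Θ i)
  uniform : ∀ i, pdf.IsUniform (Θ i) (Set.Ico 0 (2 * Real.pi)) P volume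
  indep : iIndepFun Θ P
  indep_points : IndepFun (fun ω i => Θ i ω) (fun ω i => X i ω) P

end PointProcess

/-- The set of indices of the base stations nearest to the UE at time `s`
(the `argmin` over the stations of the distance to the UE). Here `b i s` is the position of the
`i`-th station, and `u s` that of the UE, at time `s`. -/
def serving (b : ℕ → ℝ → Space) (u : ℝ → Space) (s : ℝ) : Set ℕ :=
  {i | ∀ j, dist (b i s) (u s) ≤ dist (b j s) (u s)}

/-- A handover takes place until time `t`: at some earlier time `s` the nearest station is not the
one that is nearest at time `t`. -/
def HandoverBy (b : ℕ → ℝ → Space) (u : ℝ → Space) (t : ℝ) : Prop :=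
  ∃ s : ℝ, 0 ≤ s ∧ s < t ∧ serving b u s ≠ serving b u t

/-- Handover event of the terrestrial network: static stations `X i` at height `h`, and a UE on
the ground that starts at `p` and moves at speed `v` in the direction `Ψ`. -/
def terrestrialHandover {Ω : Type*} (h v : ℝ) (p : Plane) (X : ℕ → Ω → Plane) (Ψ : Ω → ℝ)
    (t : ℝ) : Set Ω :=
  {ω | HandoverBy (fun i _ => atHeight h (X i ω)) (fun s => atHeight 0 (move v p (Ψ ω) s)) t}

/-- Handover event of the aerial network: stations at height `h` that start at `X i` and
move at the common speed `v` in the directions `Θ i`, and a static UE on the ground at `q`. -/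
def aerialHandover {Ω : Type*} (h v : ℝ) (q : Plane) (X : ℕ → Ω → Plane) (Θ : ℕ → Ω → ℝ)
    (t : ℝ) : Set Ω :=
  {ω | HandoverBy (fun i s => atHeight h (move v (X i ω) (Θ i ω) s)) (fun _ => atHeight 0 q) t}

end Handover

namespace Handover

/-! Pass to coordinates in which each station-UE pair becomes a fixed point of the plane seen from a
moving probe. Rotating the relative position by the angle of motion (`frame`) makes the probe travel
along `s • (-v, 0)` in both networks, even when every drone has its own direction (`dist_frame`).
Heights only add a common constant to squared distances. Voronoi cells are convex, so a handover
occurs before `t > 0` exactly when the nearest points at the two ends of the probe's segment differ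
(`handoverBy_iff`).

This is an event about a locally finite configuration that void events determine
(`exists_measurableSet_nearest_ne`). Void events form a π-system, so it suffices that both rotated
configurations have the same void probabilities (`measure_eq_of_voidEvent`). Both equal `exp (-lam *
vol B)`: a common rotation independent of the points preserves Lebesgue measure
(`measure_void_frame_direction`); individual rotations are handled by marking the Poisson process
(`measure_marked_void`), which rests on its generating functional. -/

/-- Indices of the points of the configuration `w` that are nearest to `z`. -/
def nearest {E : Type*} [PseudoMetricSpace E] (w : ℕ → E) (z : E) : Set ℕ :=
  {i | ∀ j, dist (w i) z ≤ dist (w j) z}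

/-- Every ball contains only finitely many points of the configuration, with multiplicity. -/
def FiniteInBalls {E : Type*} [PseudoMetricSpace E] (w : ℕ → E) : Prop :=
  ∀ (z : E) (R : ℝ), {i | w i ∈ Metric.ball z R}.Finite

/-- The configurations without points in `B`. -/
def voidEvent {E : Type*} (B : Set E) : Set (ℕ → E) := {w | ∀ i, w i ∉ B}

/-! ### Nearest points read off from void events -/

section Metric

variable {E : Type*} [PseudoMetricSpace E]

/-- Local finiteness leaves a gap between the least distance to `z` and the next one; a radius in
that gap isolates the nearest points. It is rational so that later conditions on radii are
countable. -/
lemma FiniteInBalls.exists_ball {w : ℕ → E} (hw : FiniteInBalls w) (z : E) :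
    ∃ r : ℚ, (∃ i, w i ∈ Metric.ball z r) ∧ ∀ i, w i ∈ Metric.ball z r → i ∈ nearest w z := by
  have hfin := hw z (dist (w 0) z + 1)
  obtain ⟨m, hmS, hm⟩ := Set.exists_min_image _ (fun i => dist (w i) z) hfin ⟨0, by simp⟩
  have hmn : m ∈ nearest w z := fun j => by
    by_cases hj : w j ∈ Metric.ball z (dist (w 0) z + 1)
    · exact hm j hj
    · have h0 := hm 0 (by simp)
      simp only [Metric.mem_ball, not_lt] at hj
      linarith
  have hU := hfin.subset (Set.sdiff_subset (t := nearest w z))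
  have hev : ∀ᶠ r in nhds (dist (w m) z),
      ∀ i ∈ {i | w i ∈ Metric.ball z (dist (w 0) z + 1)} \ nearest w z, r < dist (w i) z := by
    rw [Filter.eventually_all_finite hU]
    rintro i ⟨-, hi⟩
    refine eventually_lt_nhds ?_
    by_contra! h
    exact hi fun j => h.trans (hmn j)
  obtain ⟨r, ⟨hr1, hr2⟩, hr3⟩ := (((hev.and (eventually_lt_nhds
    (show dist (w m) z < dist (w 0) z + 1 from hmS))).filter_mono nhdsWithin_le_nhds).and
    (self_mem_nhdsWithin (s := Set.Ioi (dist (w m) z)))).exists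
  obtain ⟨q, hq1, hq2⟩ := exists_rat_btwn (show dist (w m) z < r from hr3)
  refine ⟨q, ⟨m, hq1⟩, fun i hi => ?_⟩
  rw [Metric.mem_ball] at hi
  by_contra hin
  have := hr1 i ⟨by rw [Set.mem_ofPred_eq, Metric.mem_ball]; linarith, hin⟩
  linarith

lemma FiniteInBalls.nonempty_nearest {w : ℕ → E} (hw : FiniteInBalls w) (z : E) :
    (nearest w z).Nonempty := by
  obtain ⟨r, ⟨i, hi⟩, h⟩ := hw.exists_ball z
  exact ⟨i, h i hi⟩

lemma FiniteInBalls.finite_nearest {w : ℕ → E} (hw : FiniteInBalls w) (z : E) :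
    (nearest w z).Finite :=
  (hw z (dist (w 0) z + 1)).subset fun _ hi => lt_of_le_of_lt (hi 0) (lt_add_one _)

/-- A nearest point in `Q` lies in every nonempty ball about `z`. Conversely, the ball of
`exists_ball` contains nearest points only. -/
lemma FiniteInBalls.exists_nearest_mem_iff {w : ℕ → E} (hw : FiniteInBalls w) (z : E)
    (Q : Set E) : (∃ i ∈ nearest w z, w i ∈ Q) ↔
      ∀ r : ℚ, w ∈ voidEvent (Metric.ball z r) ∪ (voidEvent (Metric.ball z r ∩ Q))ᶜ := by
  constructor
  · rintro ⟨i, hi, hQ⟩ r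
    rw [Set.mem_union, or_iff_not_imp_left]
    intro h
    simp only [voidEvent, Set.mem_ofPred_eq, not_forall, not_not] at h
    obtain ⟨j, hj⟩ := h
    exact fun hv => hv i ⟨(hi j).trans_lt hj, hQ⟩
  · intro h
    obtain ⟨r, ⟨i, hi⟩, hr⟩ := hw.exists_ball z
    rcases h r with h | h
    · exact absurd hi (h i)
    · simp only [voidEvent, Set.mem_compl_iff, Set.mem_ofPred_eq, not_forall, not_not] at h
      obtain ⟨j, hj, hjQ⟩ := h
      exact ⟨j, hr j hj, hjQ⟩

end Metric

section Separation

variable {E : Type*} [MetricSpace E] [SecondCountableTopology E]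

/-- A nearest set contains every index whose point coincides with that of a member, so it is
determined by its positions. These form a finite, hence closed, set, and a basic open set separates
any other point from it. -/
lemma FiniteInBalls.nearest_subset {w : ℕ → E} (hw : FiniteInBalls w) {a b : E}
    (h : ∀ Q ∈ TopologicalSpace.countableBasis E,
      (∃ i ∈ nearest w a, w i ∈ Q) → ∃ i ∈ nearest w b, w i ∈ Q) :
    nearest w a ⊆ nearest w b := by
  intro i hi
  by_contra hib
  have hclosed : IsClosed (w '' nearest w b) := ((hw.finite_nearest b).image w).isClosed
  have hmem : w i ∈ (w '' nearest w b)ᶜ := by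
    rintro ⟨j, hj, hji⟩
    exact hib fun k => by rw [← hji]; exact hj k
  obtain ⟨Q, hQ, hiQ, hsub⟩ := (TopologicalSpace.isBasis_countableBasis E).exists_subset_of_mem_open
    hmem hclosed.isOpen_compl
  obtain ⟨j, hj, hjQ⟩ := h Q hQ ⟨i, hi, hiQ⟩
  exact hsub hjQ ⟨j, hj, rfl⟩

lemma FiniteInBalls.nearest_ne_iff {w : ℕ → E} (hw : FiniteInBalls w) (a b : E) :
    nearest w a ≠ nearest w b ↔ ∃ Q ∈ TopologicalSpace.countableBasis E,
      ¬ ((∃ i ∈ nearest w a, w i ∈ Q) ↔ ∃ i ∈ nearest w b, w i ∈ Q) := by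
  constructor
  · intro h
    by_contra! hall
    exact h (Set.Subset.antisymm (hw.nearest_subset fun Q hQ => (hall Q hQ).1)
      (hw.nearest_subset fun Q hQ => (hall Q hQ).2))
  · rintro ⟨Q, -, hQ⟩ h
    exact hQ (by rw [h])

end Separation

/-! ### Laws determined by void probabilities -/

section VoidSigmaAlgebra

variable {E : Type*} [MetricSpace E] [MeasurableSpace E]

/-- The `σ`-algebra on configurations generated by the void events of bounded measurable sets. -/
@[reducible] def voidSigmaAlgebra (E : Type*) [MetricSpace E] [MeasurableSpace E] :
    MeasurableSpace (ℕ → E) :=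
  MeasurableSpace.generateFrom
    {V | ∃ B : Set E, MeasurableSet B ∧ Bornology.IsBounded B ∧ V = voidEvent B}

lemma measurableSet_voidEvent {E : Type*} [MeasurableSpace E] {B : Set E} (hB : MeasurableSet B) :
    MeasurableSet (voidEvent B) := by
  have : voidEvent B = ⋂ i, (fun w : ℕ → E => w i) ⁻¹' Bᶜ := by ext; simp [voidEvent]
  rw [this]
  exact MeasurableSet.iInter fun i => measurable_pi_apply i hB.compl

lemma voidSigmaAlgebra_le : voidSigmaAlgebra E ≤ MeasurableSpace.pi := by
  refine MeasurableSpace.generateFrom_le ?_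
  rintro _ ⟨B, hB, -, rfl⟩
  exact measurableSet_voidEvent hB

/-- π-λ argument: the void events of `B` and `C` intersect in the void event of `B ∪ C`. -/
lemma measure_eq_of_voidEvent {ν₁ ν₂ : Measure (ℕ → E)} [IsProbabilityMeasure ν₁]
    [IsProbabilityMeasure ν₂]
    (h : ∀ B, MeasurableSet B → Bornology.IsBounded B → ν₁ (voidEvent B) = ν₂ (voidEvent B))
    {A : Set (ℕ → E)} (hA : MeasurableSet[voidSigmaAlgebra E] A) : ν₁ A = ν₂ A := by
  induction A, hA using MeasurableSpace.induction_on_inter (m := voidSigmaAlgebra E) rfl with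
  | h_inter =>
    rintro _ ⟨B, hB, hBb, rfl⟩ _ ⟨C, hC, hCb, rfl⟩ -
    exact ⟨B ∪ C, hB.union hC, hBb.union hCb, by
      ext w; simp [voidEvent, not_or, forall_and]⟩
  | empty => simp
  | basic s hs =>
    obtain ⟨B, hB, hBb, rfl⟩ := hs
    exact h B hB hBb
  | compl s hs ih =>
    have := voidSigmaAlgebra_le _ hs
    rw [prob_compl_eq_one_sub this, prob_compl_eq_one_sub this, ih]
  | iUnion f hd hf ih =>
    rw [measure_iUnion hd fun i => voidSigmaAlgebra_le _ (hf i),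
      measure_iUnion hd fun i => voidSigmaAlgebra_le _ (hf i)]
    exact tsum_congr ih

/-- On configurations with finitely many points in balls, a change of the nearest points is an
event of the void `σ`-algebra. -/
lemma exists_measurableSet_nearest_ne [SecondCountableTopology E] [BorelSpace E] (a b : E) :
    ∃ A, MeasurableSet[voidSigmaAlgebra E] A ∧
      ∀ w, FiniteInBalls w → (w ∈ A ↔ nearest w a ≠ nearest w b) := by
  have hV : ∀ B : Set E, MeasurableSet B → Bornology.IsBounded B →
      MeasurableSet[voidSigmaAlgebra E] (voidEvent B) :=
    fun B hB hb => MeasurableSpace.measurableSet_generateFrom ⟨B, hB, hb, rfl⟩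
  let T : E → Set E → Set (ℕ → E) := fun z Q =>
    ⋂ r : ℚ, voidEvent (Metric.ball z r) ∪ (voidEvent (Metric.ball z r ∩ Q))ᶜ
  have hT : ∀ z, ∀ Q ∈ TopologicalSpace.countableBasis E,
      MeasurableSet[voidSigmaAlgebra E] (T z Q) := by
    intro z Q hQ
    have hQm := (TopologicalSpace.isOpen_of_mem_countableBasis hQ).measurableSet
    refine @MeasurableSet.iInter _ _ (voidSigmaAlgebra E) _ _ fun r => ?_
    refine @MeasurableSet.union _ (voidSigmaAlgebra E) _ _
      (hV _ measurableSet_ball Metric.isBounded_ball) ?_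
    exact @MeasurableSet.compl _ _ (voidSigmaAlgebra E)
      (hV _ (measurableSet_ball.inter hQm) (Metric.isBounded_ball.subset Set.inter_subset_left))
  refine ⟨⋃ Q ∈ TopologicalSpace.countableBasis E, T a Q \ T b Q ∪ T b Q \ T a Q, ?_, ?_⟩
  · refine @MeasurableSet.biUnion _ _ (voidSigmaAlgebra E) _ _
      (TopologicalSpace.countable_countableBasis E) fun Q hQ => ?_
    exact @MeasurableSet.union _ (voidSigmaAlgebra E) _ _
      (@MeasurableSet.diff _ (voidSigmaAlgebra E) _ _ (hT a Q hQ) (hT b Q hQ))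
      (@MeasurableSet.diff _ (voidSigmaAlgebra E) _ _ (hT b Q hQ) (hT a Q hQ))
  · intro w hw
    rw [hw.nearest_ne_iff]
    have hTw : ∀ z Q, w ∈ T z Q ↔ ∃ i ∈ nearest w z, w i ∈ Q := fun z Q => by
      rw [hw.exists_nearest_mem_iff, Set.mem_iInter]
    simp only [Set.mem_iUnion, Set.mem_union, Set.mem_sdiff, hTw, exists_prop]
    refine exists_congr fun Q => and_congr_right fun _ => ?_
    by_cases h1 : ∃ i ∈ nearest w a, w i ∈ Q
    all_goals by_cases h2 : ∃ i ∈ nearest w b, w i ∈ Q <;> simp only [h1, h2] <;> simp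

end VoidSigmaAlgebra

/-! ### Convexity of Voronoi cells -/

section Segment

variable {E : Type*} [NormedAddCommGroup E] [InnerProductSpace ℝ E]

/-- Stewart's identity. The last term does not involve `x`, so the difference of squared distances
from two points to `τ • d` is affine in `τ`. -/
lemma dist_smul_sq (x d : E) (τ : ℝ) : dist x (τ • d) ^ 2 =
    (1 - τ) * dist x 0 ^ 2 + τ * dist x d ^ 2 - τ * (1 - τ) * ‖d‖ ^ 2 := by
  rw [dist_eq_norm, dist_eq_norm, dist_eq_norm, sub_zero, norm_sub_sq_real, norm_sub_sq_real,
    norm_smul, inner_smul_right, mul_pow, Real.norm_eq_abs, sq_abs]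
  ring

/-- Voronoi cells are convex: if the same points are nearest at both ends of a segment, they are
the nearest ones along the segment. -/
lemma nearest_smul_eq {w : ℕ → E} {d : E} (hne : (nearest w 0).Nonempty)
    (h : nearest w 0 = nearest w d) {τ : ℝ} (h0 : 0 ≤ τ) (h1 : τ ≤ 1) :
    nearest w (τ • d) = nearest w 0 := by
  have key : ∀ i ∈ nearest w 0, ∀ j, dist (w i) (τ • d) ^ 2 ≤ dist (w j) (τ • d) ^ 2 := by
    intro i hi j
    have e0 : dist (w i) 0 ^ 2 ≤ dist (w j) 0 ^ 2 := by gcongr; exact hi j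
    have e1 : dist (w i) d ^ 2 ≤ dist (w j) d ^ 2 := by
      gcongr; rw [h] at hi; exact hi j
    rw [dist_smul_sq, dist_smul_sq]
    have := mul_le_mul_of_nonneg_left e0 (sub_nonneg.2 h1)
    have := mul_le_mul_of_nonneg_left e1 h0
    linarith
  refine Set.Subset.antisymm (fun j hj => ?_) fun i hi j =>
    (sq_le_sq₀ dist_nonneg dist_nonneg).1 (key i hi j)
  by_contra hj0
  obtain ⟨i, hi⟩ := hne
  -- If `j` is not nearest at the ends, it is strictly farther than `i` at both, hence also at `τ •
  -- d` by affinity.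
  have far : ∀ z, i ∈ nearest w z → j ∉ nearest w z → dist (w i) z ^ 2 < dist (w j) z ^ 2 := by
    intro z hiz hjz
    have : dist (w i) z < dist (w j) z := by
      by_contra! hle
      exact hjz fun k => hle.trans (hiz k)
    gcongr
  have e0 := far 0 hi hj0
  have e1 := far d (h ▸ hi) (h ▸ hj0)
  have e2 : dist (w j) (τ • d) ^ 2 ≤ dist (w i) (τ • d) ^ 2 := by gcongr; exact hj i
  rw [dist_smul_sq, dist_smul_sq] at e2
  rcases h0.eq_or_lt with rfl | hpos
  · linarith
  · have := mul_le_mul_of_nonneg_left e0.le (sub_nonneg.2 h1)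
    have := mul_lt_mul_of_pos_left e1 hpos
    linarith

lemma handoverBy_iff {b : ℕ → ℝ → Space} {u : ℝ → Space} {t : ℝ} {w : ℕ → E} {d : E}
    (hw : FiniteInBalls w) (hs : ∀ s, serving b u s = nearest w (s • d)) :
    HandoverBy b u t ↔ 0 < t ∧ nearest w 0 ≠ nearest w (t • d) := by
  simp only [HandoverBy, hs]
  constructor
  · rintro ⟨s, h0, hst, hne⟩
    have ht := h0.trans_lt hst
    refine ⟨ht, fun heq => hne ?_⟩
    have := nearest_smul_eq (hw.nonempty_nearest 0) heq (τ := s / t) (by positivity)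
      ((div_le_one ht).2 hst.le)
    rw [smul_smul, div_mul_cancel₀ _ ht.ne'] at this
    rw [this, heq]
  · rintro ⟨ht, hne⟩
    exact ⟨0, le_rfl, ht, by rwa [zero_smul]⟩

end Segment

/-! ### Generating functional and marking of Poisson processes -/

/-- Partial products of factors at most `1` decrease, so their infimum serves as the infinite
product. -/
lemma iInf_prod_range_eq {g : ℕ → ℝ≥0∞} (hg : ∀ i, g i ≤ 1) (hfin : {i | g i ≠ 1}.Finite) :
    ⨅ n, ∏ i ∈ Finset.range n, g i = ∏ i ∈ hfin.toFinset, g i := by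
  have hle : ∀ s : Finset ℕ, ∏ i ∈ hfin.toFinset, g i ≤ ∏ i ∈ s, g i := by
    intro s
    calc ∏ i ∈ hfin.toFinset, g i = ∏ i ∈ hfin.toFinset ∪ s, g i :=
          Finset.prod_subset Finset.subset_union_left fun i _ hi => by simpa using hi
      _ ≤ ∏ i ∈ s, g i :=
          Finset.prod_le_prod_of_subset_of_le_one' Finset.subset_union_right fun i _ _ => hg i
  refine le_antisymm ?_ (le_iInf fun n => hle _)
  obtain ⟨n, hn⟩ := hfin.toFinset.exists_nat_subset_range
  refine (iInf_le _ n).trans_eq (Finset.prod_subset hn fun i _ hi => by simpa using hi).symm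

section Poisson

variable {Ω E : Type*} [MeasurableSpace Ω] [MeasurableSpace E] {X : ℕ → Ω → E} {Λ : Measure E}
  {P : Measure Ω}

lemma measurable_numPoints (hX : ∀ i, Measurable (X i)) {B : Set E} (hB : MeasurableSet B) :
    Measurable (numPoints X B) := by
  refine measurable_encard.comp (measurable_set_iff.2 fun i => ?_)
  exact (measurableSet_setOfPred.1 (hX i hB))

lemma IsPoissonProcess.ae_finite (hX : IsPoissonProcess X Λ P) {B : Set E}
    (hB : MeasurableSet B) (hΛ : Λ B ≠ ∞) : ∀ᵐ ω ∂P, {i | X i ω ∈ B}.Finite := by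
  have h := (hX.count_law B hB hΛ).measure_eq (p := fun n => n = ⊤) (MeasurableSet.of_discrete)
  rw [Measure.map_apply .of_discrete .of_discrete] at h
  have h0 : P {ω | numPoints X B ω = ⊤} = 0 := by
    rw [h]
    convert measure_empty (μ := poissonMeasure (Λ B).toNNReal)
    ext n
    simp
  rw [ae_iff]
  convert h0 using 3 with ω
  simp [numPoints]

lemma IsPoissonProcess.measure_void (hX : IsPoissonProcess X Λ P) {B : Set E}
    (hB : MeasurableSet B) (hΛ : Λ B ≠ ∞) :
    P {ω | ∀ i, X i ω ∉ B} = ENNReal.ofReal (Real.exp (-(Λ B).toReal)) := by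
  have h := (hX.count_law B hB hΛ).measure_eq (p := fun n => n = 0) (MeasurableSet.of_discrete)
  rw [Measure.map_apply .of_discrete .of_discrete] at h
  have e1 : {ω | ∀ i, X i ω ∉ B} = {ω | numPoints X B ω = 0} := by
    ext ω
    simp [numPoints, Set.eq_empty_iff_forall_notMem]
  have e2 : (fun n : ℕ => (n : ℕ∞)) ⁻¹' {x | x = 0} = {0} := by ext; simp
  rw [e1, h, e2, poissonMeasure_singleton]
  simp [ENNReal.coe_toNNReal_eq_toReal]

lemma lintegral_pow_poissonMeasure (r : ℝ≥0) {c : ℝ≥0∞} (hc : c ≤ 1) :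
    ∫⁻ n, c ^ n ∂(poissonMeasure r) = ENNReal.ofReal (Real.exp (-((1 - c) * r).toReal)) := by
  lift c to ℝ≥0 using ne_top_of_le_ne_top ENNReal.one_ne_top hc
  have hc' : c ≤ 1 := by exact_mod_cast hc
  rw [poissonMeasure, lintegral_sum_measure]
  simp only [lintegral_smul_measure, lintegral_dirac, smul_eq_mul]
  have hs : HasSum (fun n : ℕ => Real.exp (-r) * r ^ n / (n.factorial) * (c : ℝ) ^ n)
      (Real.exp (-r) * Real.exp (r * c)) := by
    have := (NormedSpace.expSeries_div_hasSum_exp ((r : ℝ) * c)).mul_left (Real.exp (-r))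
    rw [← Real.exp_eq_exp_ℝ] at this
    refine Eq.mp (congrArg (fun F => HasSum F _) (funext fun n => ?_)) this
    rw [mul_pow]; ring
  have ht : ∀ n : ℕ, ENNReal.ofReal (Real.exp (-r) * r ^ n / (n.factorial)) * (c : ℝ≥0∞) ^ n =
      ENNReal.ofReal (Real.exp (-r) * r ^ n / (n.factorial) * (c : ℝ) ^ n) := fun n => by
    rw [ENNReal.ofReal_mul (by positivity), ENNReal.ofReal_pow (by positivity),
      ENNReal.ofReal_coe_nnreal]
  simp_rw [ht]
  rw [← ENNReal.ofReal_tsum_of_nonneg (fun n => by positivity) hs.summable, hs.tsum_eq,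
    ← Real.exp_add]
  congr 2
  rw [ENNReal.toReal_mul, ENNReal.toReal_sub_of_le hc ENNReal.one_ne_top]
  simp
  ring

lemma IsPoissonProcess.lintegral_pow_numPoints (hX : IsPoissonProcess X Λ P) {B : Set E}
    (hB : MeasurableSet B) (hΛ : Λ B ≠ ∞) {c : ℝ≥0∞} (hc : c ≤ 1) :
    ∫⁻ ω, c ^ (numPoints X B ω).toNat ∂P =
      ENNReal.ofReal (Real.exp (-((1 - c) * Λ B).toReal)) := by
  have hN := hX.count_law B hB hΛ
  rw [← lintegral_map' (f := fun n : ℕ∞ => c ^ n.toNat) Measurable.of_discrete.aemeasurable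
    hN.aemeasurable, hN.map_eq, lintegral_map .of_discrete .of_discrete]
  simp only [ENat.toNat_natCast]
  rw [lintegral_pow_poissonMeasure _ hc, ENNReal.coe_toNNReal hΛ]

lemma IsPoissonProcess.lintegral_iInf_prod_simpleFunc [IsProbabilityMeasure P]
    (hX : IsPoissonProcess X Λ P) (f : SimpleFunc E ℝ≥0∞) (hf : ∀ x, f x ≤ 1)
    (hΛ : Λ (f ⁻¹' {1}ᶜ) ≠ ∞) :
    ∫⁻ ω, ⨅ n, ∏ i ∈ Finset.range n, f (X i ω) ∂P =
      ENNReal.ofReal (Real.exp (-(∫⁻ x, (1 - f x) ∂Λ).toReal)) := by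
  classical
  -- Grouping factors by value gives a product of powers with independent Poisson exponents. The
  -- value `1` is dropped: its level set may have infinite intensity, and it contributes nothing.
  set s := f.range.erase 1 with hs
  have hs1 : ∀ c ∈ s, c ≤ 1 := fun c hc => by
    obtain ⟨x, rfl⟩ := SimpleFunc.mem_range.1 (Finset.mem_of_mem_erase hc)
    exact hf x
  have hsΛ : ∀ c ∈ s, Λ (f ⁻¹' {c}) ≠ ∞ := fun c hc =>
    ne_top_of_le_ne_top hΛ (measure_mono fun x hx => by
      rw [Set.mem_preimage, Set.mem_singleton_iff] at hx
      simpa [hx] using Finset.ne_of_mem_erase hc)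
  have hae : ∀ᵐ ω ∂P, ⨅ n, ∏ i ∈ Finset.range n, f (X i ω) =
      ∏ c ∈ s, c ^ (numPoints X (f ⁻¹' {c}) ω).toNat := by
    filter_upwards [hX.ae_finite (f.measurableSet_preimage _) hΛ] with ω hω
    have hω' : {i | f (X i ω) ≠ 1}.Finite := hω
    rw [iInf_prod_range_eq (fun i => hf _) hω',
      ← Finset.prod_fiberwise_of_maps_to (s := hω'.toFinset) (t := s) (g := fun i => f (X i ω))]
    · refine Finset.prod_congr rfl fun c hc => ?_
      rw [Finset.prod_congr rfl (fun i hi => (Finset.mem_filter.1 hi).2), Finset.prod_const]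
      congr 1
      have : {i | X i ω ∈ f ⁻¹' {c}} =
          ((hω'.toFinset.filter fun i => f (X i ω) = c : Finset ℕ) : Set ℕ) := by
        ext i
        have := Finset.ne_of_mem_erase hc
        simp only [Set.mem_preimage, Set.mem_singleton_iff, Finset.coe_filter,
          Set.Finite.mem_toFinset]
        constructor
        · intro h
          exact ⟨by rw [Set.mem_ofPred_eq, show f (X i ω) = c from h]; exact this, h⟩
        · exact fun h => h.2
      rw [numPoints, this, Set.encard_coe_eq_coe_finsetCard, ENat.toNat_natCast]
    · intro i hi
      exact Finset.mem_erase.2 ⟨by simpa using hi, SimpleFunc.mem_range_self _ _⟩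
  rw [lintegral_congr_ae hae]
  have hind := hX.count_indep s.card (fun j => f ⁻¹' {(s.equivFin.symm j : ℝ≥0∞)})
    (fun j => f.measurableSet_preimage _) (fun j l hjl => by
      refine Disjoint.preimage _ (Set.disjoint_singleton.2 fun h => hjl ?_)
      exact s.equivFin.symm.injective (Subtype.ext h))
  have hind' := hind.comp (fun j (n : ℕ∞) => (s.equivFin.symm j : ℝ≥0∞) ^ n.toNat)
    (fun j => .of_discrete)
  have hprod := lintegral_prod_eq_prod_lintegral_of_indepFun Finset.univ _ hind'
    (fun j => Measurable.of_discrete.comp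
      (measurable_numPoints hX.measurable (f.measurableSet_preimage _)))
  have hre : ∀ F : ℝ≥0∞ → ℝ≥0∞, ∏ j : Fin s.card, F (s.equivFin.symm j) = ∏ c ∈ s, F c :=
    fun F => by
      rw [← Finset.prod_coe_sort s F]
      exact Equiv.prod_comp s.equivFin.symm fun c : s => F c
  simp only [Function.comp_apply] at hprod
  rw [hre (fun c => ∫⁻ ω, c ^ (numPoints X (f ⁻¹' {c}) ω).toNat ∂P)] at hprod
  simp_rw [fun ω => hre (fun c => c ^ (numPoints X (f ⁻¹' {c}) ω).toNat)] at hprod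
  rw [hprod, Finset.prod_congr rfl fun c hc => hX.lintegral_pow_numPoints
    (f.measurableSet_preimage _) (hsΛ c hc) (hs1 c hc),
    ← ENNReal.ofReal_prod_of_nonneg fun _ _ => (Real.exp_pos _).le, ← Real.exp_sum,
    Finset.sum_neg_distrib, ← ENNReal.toReal_sum fun c hc =>
      ENNReal.mul_ne_top (ne_top_of_le_ne_top ENNReal.one_ne_top tsub_le_self) (hsΛ c hc)]
  congr 4
  have : ∫⁻ x, (1 - f x) ∂Λ = (f.map fun c => 1 - c).lintegral Λ := by
    rw [← SimpleFunc.lintegral_eq_lintegral]; rfl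
  rw [this, SimpleFunc.map_lintegral, hs]
  refine Finset.sum_subset (Finset.erase_subset _ _) fun c hc hc' => ?_
  have : c = 1 := by
    by_contra h
    exact hc' (Finset.mem_erase.2 ⟨h, hc⟩)
  simp [this]

/-- The probability generating functional of a Poisson process. -/
lemma IsPoissonProcess.lintegral_iInf_prod [IsProbabilityMeasure P]
    (hX : IsPoissonProcess X Λ P) {g : E → ℝ≥0∞} (hg : Measurable g) (hg1 : ∀ x, g x ≤ 1)
    {S : Set E} (hS : ∀ x ∉ S, g x = 0) (hΛ : Λ S ≠ ∞) :
    ∫⁻ ω, ⨅ n, ∏ i ∈ Finset.range n, (1 - g (X i ω)) ∂P =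
      ENNReal.ofReal (Real.exp (-(∫⁻ x, g x ∂Λ).toReal)) := by
  -- Simple functions increase to `g`, so the factors `1 - a k` decrease to `1 - g`; monotone
  -- convergence applies on both sides.
  let a : ℕ → SimpleFunc E ℝ≥0∞ := SimpleFunc.eapprox g
  let f : ℕ → SimpleFunc E ℝ≥0∞ := fun k => (a k).map fun c => 1 - c
  have hmono : Monotone a := SimpleFunc.monotone_eapprox g
  have hsup : ∀ x, ⨆ k, a k x = g x := SimpleFunc.iSup_eapprox_apply hg
  have hag : ∀ k x, a k x ≤ g x := fun k x => (le_iSup (fun k => a k x) k).trans_eq (hsup x)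
  have hf1 : ∀ k x, f k x ≤ 1 := fun k x => tsub_le_self
  have hanti : ∀ x, Antitone fun k => f k x := fun x k l hkl => tsub_le_tsub_left (hmono hkl x) 1
  have hlim : ∀ x, ⨅ k, f k x = 1 - g x := fun x => by
    rw [← hsup x, ENNReal.sub_iSup ENNReal.one_ne_top]; rfl
  have hint : ∀ k, ∫⁻ x, (1 - f k x) ∂Λ = ∫⁻ x, a k x ∂Λ := fun k => lintegral_congr fun x =>
    ENNReal.sub_sub_cancel ENNReal.one_ne_top ((hag k x).trans (hg1 x))
  have hgfin : ∫⁻ x, g x ∂Λ ≠ ∞ := by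
    refine ne_top_of_le_ne_top hΛ ?_
    -- `S` need not be measurable, hence the measurable hull.
    calc ∫⁻ x, g x ∂Λ ≤ ∫⁻ x, (toMeasurable Λ S).indicator 1 x ∂Λ := by
          refine lintegral_mono fun x => ?_
          by_cases hx : x ∈ S
          · simpa [subset_toMeasurable Λ S hx] using hg1 x
          · simp [hS x hx]
      _ = Λ S := by rw [lintegral_indicator_one (measurableSet_toMeasurable _ _),
          measure_toMeasurable]
  have hk : ∀ k, ∫⁻ ω, ⨅ n, ∏ i ∈ Finset.range n, f k (X i ω) ∂P =
      ENNReal.ofReal (Real.exp (-(∫⁻ x, a k x ∂Λ).toReal)) := fun k => by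
    rw [hX.lintegral_iInf_prod_simpleFunc (f k) (hf1 k), hint]
    refine ne_top_of_le_ne_top hΛ (measure_mono fun x hx => ?_)
    by_contra hxS
    refine hx ?_
    have h0 : a k x = 0 := le_antisymm ((hag k x).trans_eq (hS x hxS)) bot_le
    simp [f, h0]
  have hswap : ∀ ω, ⨅ n, ∏ i ∈ Finset.range n, (1 - g (X i ω)) =
      ⨅ k, ⨅ n, ∏ i ∈ Finset.range n, f k (X i ω) := fun ω => by
    rw [iInf_comm]
    refine iInf_congr fun n => ?_
    have h1 : Filter.Tendsto (fun k => ∏ i ∈ Finset.range n, f k (X i ω)) Filter.atTop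
        (nhds (∏ i ∈ Finset.range n, (1 - g (X i ω)))) := by
      have hle : ∀ i, 1 - g (X i ω) ≠ ∞ := fun i =>
        ne_top_of_le_ne_top ENNReal.one_ne_top tsub_le_self
      induction n with
      | zero => simp
      | succ n ih =>
        simp_rw [Finset.prod_range_succ]
        refine ENNReal.Tendsto.mul ih (Or.inr (hle n)) ?_
          (Or.inr (ENNReal.prod_ne_top fun i _ => hle i))
        rw [← hlim]
        exact tendsto_atTop_iInf (hanti _)
    exact tendsto_nhds_unique h1 (tendsto_atTop_iInf fun k l hkl =>
      Finset.prod_le_prod' fun i _ => hanti _ hkl)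
  have hmf : ∀ k, Measurable fun ω => ⨅ n, ∏ i ∈ Finset.range n, f k (X i ω) := fun k =>
    Measurable.iInf fun n => Finset.measurable_fun_prod _ fun i _ =>
      (f k).measurable.comp (hX.measurable i)
  simp_rw [hswap]
  rw [lintegral_iInf (fun k => hmf k)
    (fun k l hkl ω => iInf_mono fun n => Finset.prod_le_prod' fun i _ => hanti _ hkl)
    (by rw [hk]; exact ENNReal.ofReal_ne_top)]
  have hanti' : Antitone fun k => ∫⁻ ω, ⨅ n, ∏ i ∈ Finset.range n, f k (X i ω) ∂P :=
    fun k l hkl => lintegral_mono fun ω => iInf_mono fun n =>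
      Finset.prod_le_prod' fun i _ => hanti _ hkl
  refine tendsto_nhds_unique (tendsto_atTop_iInf hanti') ?_
  simp_rw [hk]
  have hconv : Filter.Tendsto (fun k => ∫⁻ x, a k x ∂Λ) Filter.atTop (nhds (∫⁻ x, g x ∂Λ)) := by
    refine lintegral_tendsto_of_tendsto_of_monotone (fun k => (a k).measurable.aemeasurable)
      (Filter.Eventually.of_forall fun x k l hkl => hmono hkl x)
      (Filter.Eventually.of_forall fun x => ?_)
    rw [← hsup x]
    exact tendsto_atTop_iSup fun k l hkl => hmono hkl x
  have hexp := ENNReal.continuous_ofReal.comp (Real.continuous_exp.comp continuous_neg)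
  exact hexp.continuousAt.tendsto.comp ((ENNReal.tendsto_toReal hgfin).comp hconv)

/-- Void probabilities of a Poisson process with independent identically distributed marks. -/
lemma IsPoissonProcess.measure_marked_void [IsProbabilityMeasure P] [SFinite Λ]
    (hX : IsPoissonProcess X Λ P) {F : Type*} [MeasurableSpace F] {μ : Measure F}
    [IsProbabilityMeasure μ] {Θ : ℕ → Ω → F} (hΘ : ∀ i, Measurable (Θ i))
    (hlaw : ∀ i, P.map (Θ i) = μ) (hind : iIndepFun Θ P)
    (hΘX : IndepFun (fun ω i => Θ i ω) (fun ω i => X i ω) P) {C : Set (E × F)}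
    (hC : MeasurableSet C) {S : Set E} (hS : ∀ z ∈ C, z.1 ∈ S) (hΛ : Λ S ≠ ∞) :
    P {ω | ∀ i, (X i ω, Θ i ω) ∉ C} =
      ENNReal.ofReal (Real.exp (-(Λ.prod μ C).toReal)) := by
  have hmX : Measurable fun ω i => X i ω := measurable_pi_lambda _ hX.measurable
  have hmΘ : Measurable fun ω i => Θ i ω := measurable_pi_lambda _ hΘ
  have : IsProbabilityMeasure (P.map fun ω i => Θ i ω) :=
    Measure.isProbabilityMeasure_map hmΘ.aemeasurable
  have : IsProbabilityMeasure (P.map fun ω i => X i ω) :=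
    Measure.isProbabilityMeasure_map hmX.aemeasurable
  let D : Set ((ℕ → F) × (ℕ → E)) := ⋂ i, {z | (z.2 i, z.1 i) ∈ Cᶜ}
  have hD : MeasurableSet D := MeasurableSet.iInter fun i =>
    (((measurable_pi_apply i).comp measurable_snd).prodMk
      ((measurable_pi_apply i).comp measurable_fst)) hC.compl
  have hg : Measurable fun x => μ (Prod.mk x ⁻¹' C) := measurable_measure_prodMk_left hC
  -- With the points fixed, independence of the marks turns the void probability into a product;
  -- integrating over the points gives the generating functional at `x ↦ μ (Prod.mk x ⁻¹' C)`.
  have hsec : ∀ x : ℕ → E, (P.map fun ω i => Θ i ω) ((fun θ => (θ, x)) ⁻¹' D) =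
      ⨅ n, ∏ i ∈ Finset.range n, (1 - μ (Prod.mk (x i) ⁻¹' C)) := by
    intro x
    have hm : ∀ i, MeasurableSet (Prod.mk (x i) ⁻¹' C) := fun i => measurable_prodMk_left hC
    rw [Measure.map_apply hmΘ (measurable_prodMk_right hD)]
    have e : (fun ω i => Θ i ω) ⁻¹' ((fun θ => (θ, x)) ⁻¹' D) =
        ⋂ n, ⋂ i ∈ Finset.range n, Θ i ⁻¹' (Prod.mk (x i) ⁻¹' C)ᶜ := by
      ext ω
      simp only [D, Set.mem_preimage, Set.mem_iInter, Finset.mem_range]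
      exact ⟨fun h n i _ => h i, fun h i => h (i + 1) i (Nat.lt_succ_self i)⟩
    rw [e, Antitone.measure_iInter (fun k l hkl =>
        Set.biInter_subset_biInter_left (Finset.range_mono hkl))
      (fun n => (Finset.measurableSet_biInter _ fun i _ =>
        hΘ i (hm i).compl).nullMeasurableSet) ⟨0, measure_ne_top _ _⟩]
    refine iInf_congr fun n => ?_
    rw [hind.measure_inter_preimage_eq_mul _ fun i _ => (hm i).compl]
    refine Finset.prod_congr rfl fun i _ => ?_
    rw [← Measure.map_apply (hΘ i) (hm i).compl, hlaw, prob_compl_eq_one_sub (hm i)]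
  have e : {ω | ∀ i, (X i ω, Θ i ω) ∉ C} = (fun ω => (fun i => Θ i ω, fun i => X i ω)) ⁻¹' D := by
    ext ω
    simp [D]
  rw [e, ← Measure.map_apply (hmΘ.prodMk hmX) hD, hΘX.map_prod_eq_prod_map_map hmΘ.aemeasurable
    hmX.aemeasurable, Measure.prod_apply_symm hD]
  simp_rw [hsec]
  have hmprod : Measurable fun x : ℕ → E =>
      ⨅ n, ∏ i ∈ Finset.range n, (1 - μ (Prod.mk (x i) ⁻¹' C)) :=
    Measurable.iInf fun n => Finset.measurable_fun_prod _ fun i _ =>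
      measurable_const.sub (hg.comp (measurable_pi_apply i))
  rw [lintegral_map hmprod hmX,
    hX.lintegral_iInf_prod hg (fun x => prob_le_one) (S := S) _ hΛ, Measure.prod_apply hC]
  intro x hx
  have : Prod.mk x ⁻¹' C = ∅ := by
    ext θ
    simpa using fun h => hx (hS _ h)
  rw [this, measure_empty]

end Poisson

/-! ### Reduction to a probe on a fixed segment -/

/-- Coordinates of `z` in the orthonormal frame whose first vector is `direction θ`. -/
noncomputable def frame (θ : ℝ) : Plane →ₗᵢ[ℝ] Plane where
  toFun z := !₂[z 0 * Real.cos θ + z 1 * Real.sin θ, z 1 * Real.cos θ - z 0 * Real.sin θ]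
  map_add' x y := by
    ext i; fin_cases i <;> simp <;> ring
  map_smul' c x := by
    ext i; fin_cases i <;> simp <;> ring
  norm_map' z := by
    simp only [EuclideanSpace.norm_eq, Fin.sum_univ_two, Real.norm_eq_abs, sq_abs,
      LinearMap.coe_mk, AddHom.coe_mk]
    congr 1
    simp only [Matrix.cons_val_zero, Matrix.cons_val_one]
    linear_combination (z 0 ^ 2 + z 1 ^ 2) * Real.sin_sq_add_cos_sq θ

lemma frame_apply_zero (θ : ℝ) (z : Plane) :
    frame θ z 0 = z 0 * Real.cos θ + z 1 * Real.sin θ := rfl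

lemma frame_apply_one (θ : ℝ) (z : Plane) :
    frame θ z 1 = z 1 * Real.cos θ - z 0 * Real.sin θ := rfl

lemma measurable_frame : Measurable fun a : ℝ × Plane => frame a.1 a.2 := by
  refine Continuous.measurable ?_
  refine (PiLp.continuous_toLp 2 _).comp (continuous_pi fun i => ?_)
  fin_cases i <;> simp <;> fun_prop

lemma measurable_frame_apply {α : Type*} [MeasurableSpace α] {f : α → ℝ} {g : α → Plane}
    (hf : Measurable f) (hg : Measurable g) : Measurable fun a => frame (f a) (g a) := by
  have h := measurable_frame.comp (hf.prodMk hg)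
  simpa only [Function.comp_def] using h

lemma measurePreserving_frame (θ : ℝ) : MeasurePreserving (frame θ) volume volume :=
  (LinearIsometry.toLinearIsometryEquiv (frame θ) rfl).measurePreserving

/-- The rotation sends `direction θ` to the first basis vector, so the probe's path no longer
depends on `θ`. -/
lemma dist_frame (θ v s : ℝ) (x y : Plane) :
    dist (frame θ (x - y)) (s • (!₂[-v, 0] : Plane)) = dist (move v x θ s) y := by
  rw [EuclideanSpace.dist_eq, EuclideanSpace.dist_eq]
  congr 1
  simp only [Fin.sum_univ_two, Real.dist_eq, sq_abs, frame_apply_zero, frame_apply_one, move,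
    direction, PiLp.sub_apply, PiLp.add_apply, PiLp.smul_apply,
    Matrix.cons_val_zero, Matrix.cons_val_one, smul_eq_mul]
  linear_combination ((x 0 - y 0) ^ 2 + (x 1 - y 1) ^ 2 - (v * s) ^ 2) * Real.sin_sq_add_cos_sq θ

lemma dist_atHeight_sq (h h' : ℝ) (x y : Plane) :
    dist (atHeight h x) (atHeight h' y) ^ 2 = dist x y ^ 2 + (h - h') ^ 2 := by
  rw [EuclideanSpace.dist_eq, EuclideanSpace.dist_eq, Real.sq_sqrt (by positivity),
    Real.sq_sqrt (by positivity)]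
  simp [Fin.sum_univ_three, Fin.sum_univ_two, Real.dist_eq, sq_abs, atHeight]

lemma serving_eq_nearest {E : Type*} [PseudoMetricSpace E] {b : ℕ → ℝ → Space} {u : ℝ → Space}
    {s c : ℝ} {w : ℕ → E} {z : E}
    (h : ∀ i, dist (b i s) (u s) ^ 2 = dist (w i) z ^ 2 + c) :
    serving b u s = nearest w z := by
  ext i
  refine forall_congr' fun j => ?_
  rw [← sq_le_sq₀ dist_nonneg dist_nonneg, h, h, add_le_add_iff_right,
    sq_le_sq₀ dist_nonneg dist_nonneg]

lemma mem_aerialHandover_iff {Ω : Type*} {h v : ℝ} {q : Plane} {Y : ℕ → Ω → Plane}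
    {Θ : ℕ → Ω → ℝ} {t : ℝ} {ω : Ω} (hw : FiniteInBalls fun i => frame (Θ i ω) (Y i ω - q)) :
    ω ∈ aerialHandover h v q Y Θ t ↔ 0 < t ∧
      nearest (fun i => frame (Θ i ω) (Y i ω - q)) 0 ≠
        nearest (fun i => frame (Θ i ω) (Y i ω - q)) (t • (!₂[-v, 0] : Plane)) :=
  handoverBy_iff hw fun s => serving_eq_nearest (c := (h - 0) ^ 2) fun i => by
    rw [dist_frame, dist_atHeight_sq]

/-- The UE is now the moving object of `dist_frame`; the sign in `p - X i` gives the probe the same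
path as in the aerial network. -/
lemma mem_terrestrialHandover_iff {Ω : Type*} {h v : ℝ} {p : Plane} {X : ℕ → Ω → Plane}
    {Ψ : Ω → ℝ} {t : ℝ} {ω : Ω} (hw : FiniteInBalls fun i => frame (Ψ ω) (p - X i ω)) :
    ω ∈ terrestrialHandover h v p X Ψ t ↔ 0 < t ∧
      nearest (fun i => frame (Ψ ω) (p - X i ω)) 0 ≠
        nearest (fun i => frame (Ψ ω) (p - X i ω)) (t • (!₂[-v, 0] : Plane)) :=
  handoverBy_iff hw fun s => serving_eq_nearest (c := (h - 0) ^ 2) fun i => by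
    rw [dist_frame, dist_atHeight_sq, dist_comm]

lemma FiniteInBalls.of_norm_eq_dist {w y : ℕ → Plane} {q : Plane}
    (h : ∀ i, ‖w i‖ = dist (y i) q)
    (hy : ∀ n : ℕ, {i | y i ∈ Metric.ball q n}.Finite) : FiniteInBalls w := by
  intro z R
  obtain ⟨n, hn⟩ := exists_nat_gt (R + ‖z‖)
  refine (hy n).subset fun i hi => ?_
  have hi' : ‖w i - z‖ < R := by simpa [dist_eq_norm] using hi
  rw [Set.mem_ofPred_eq, Metric.mem_ball, ← h]
  have := norm_le_norm_sub_add (w i) z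
  linarith

/-! ### Void probabilities of the two rotated configurations -/

section Laws

variable {Ω : Type*} [MeasurableSpace Ω] {P : Measure Ω} {lam : ℝ≥0}

lemma smul_volume_ne_top {B : Set Plane} (hB : Bornology.IsBounded B) :
    (lam • (volume : Measure Plane)) B ≠ ∞ :=
  ENNReal.mul_ne_top ENNReal.coe_ne_top hB.measure_lt_top.ne

lemma IsHomogeneousPPP.ae_finiteInBalls {X : ℕ → Ω → Plane} (hX : IsHomogeneousPPP X lam P)
    (q : Plane) {W : ℕ → Ω → Plane} (hW : ∀ i ω, ‖W i ω‖ = dist (X i ω) q) :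
    ∀ᵐ ω ∂P, FiniteInBalls fun i => W i ω := by
  have h : ∀ᵐ ω ∂P, ∀ n : ℕ, {i | X i ω ∈ Metric.ball q n}.Finite := ae_all_iff.2 fun n =>
    IsPoissonProcess.ae_finite hX measurableSet_ball (smul_volume_ne_top Metric.isBounded_ball)
  filter_upwards [h] with ω hω
  exact FiniteInBalls.of_norm_eq_dist (fun i => hW i ω) hω

/-- For each fixed angle the map preserves Lebesgue measure, so the conditional void probability is
constant and the law of `Ψ` integrates out. -/
lemma IsHomogeneousPPP.measure_void_frame_direction [IsProbabilityMeasure P]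
    {X : ℕ → Ω → Plane} (hX : IsHomogeneousPPP X lam P) {Ψ : Ω → ℝ} (hΨ : Measurable Ψ)
    (hΨX : IndepFun Ψ (fun ω i => X i ω) P) (p : Plane) {B : Set Plane} (hB : MeasurableSet B)
    (hb : Bornology.IsBounded B) :
    P {ω | ∀ i, frame (Ψ ω) (p - X i ω) ∉ B} =
      ENNReal.ofReal (Real.exp (-((lam • (volume : Measure Plane)) B).toReal)) := by
  have hmX : Measurable fun ω i => X i ω :=
    measurable_pi_lambda _ (IsPoissonProcess.measurable hX)
  have : IsProbabilityMeasure (P.map Ψ) := Measure.isProbabilityMeasure_map hΨ.aemeasurable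
  have : IsProbabilityMeasure (P.map fun ω i => X i ω) :=
    Measure.isProbabilityMeasure_map hmX.aemeasurable
  let D : Set (ℝ × (ℕ → Plane)) := ⋂ i, {z | frame z.1 (p - z.2 i) ∈ Bᶜ}
  have hD : MeasurableSet D := MeasurableSet.iInter fun i =>
    measurable_frame_apply measurable_fst
      (Measurable.const_sub (f := fun z : ℝ × (ℕ → Plane) => z.2 i)
        ((measurable_pi_apply i).comp measurable_snd) p) hB.compl
  have hsec : ∀ ψ, (P.map fun ω i => X i ω) (Prod.mk ψ ⁻¹' D) =
      ENNReal.ofReal (Real.exp (-((lam • (volume : Measure Plane)) B).toReal)) := by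
    intro ψ
    have hmp : MeasurePreserving (fun x => frame ψ (p - x)) (volume : Measure Plane) volume :=
      (measurePreserving_frame ψ).comp (Measure.measurePreserving_sub_left volume p)
    have hpre : (lam • (volume : Measure Plane)) ((fun x => frame ψ (p - x)) ⁻¹' B) =
        (lam • (volume : Measure Plane)) B := by
      rw [Measure.smul_apply, Measure.smul_apply, hmp.measure_preimage hB.nullMeasurableSet]
    rw [Measure.map_apply hmX (measurable_prodMk_left hD), ← hpre,
      ← IsPoissonProcess.measure_void hX (hmp.measurable hB)
        (by rw [hpre]; exact smul_volume_ne_top hb)]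
    congr 1
    ext ω
    simp [D]
  have e : {ω | ∀ i, frame (Ψ ω) (p - X i ω) ∉ B} = (fun ω => (Ψ ω, fun i => X i ω)) ⁻¹' D := by
    ext ω
    simp [D]
  rw [e, ← Measure.map_apply (hΨ.prodMk hmX) hD, hΨX.map_prod_eq_prod_map_map hΨ.aemeasurable
    hmX.aemeasurable, Measure.prod_apply hD]
  simp [hsec]

lemma IsHomogeneousPPP.measure_void_frame_marks [IsProbabilityMeasure P]
    {Y : ℕ → Ω → Plane} (hY : IsHomogeneousPPP Y lam P) {Θ : ℕ → Ω → ℝ}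
    (hΘ : IsIIDUniformDirections Θ Y P) (q : Plane) {B : Set Plane} (hB : MeasurableSet B)
    (hb : Bornology.IsBounded B) :
    P {ω | ∀ i, frame (Θ i ω) (Y i ω - q) ∉ B} =
      ENNReal.ofReal (Real.exp (-((lam • (volume : Measure Plane)) B).toReal)) := by
  have : IsProbabilityMeasure
      (cond (volume : Measure ℝ) (Set.Ico 0 (2 * Real.pi))) :=
    cond_isProbabilityMeasure_of_finite (by simp [Real.pi_pos])
      (by rw [Real.volume_Ico]; exact ENNReal.ofReal_ne_top)
  let C : Set (Plane × ℝ) := (fun z => frame z.2 (z.1 - q)) ⁻¹' B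
  have hC : MeasurableSet C :=
    measurable_frame_apply measurable_snd (measurable_fst.sub_const q) hB
  -- Rotations preserve the norm, so whatever its mark, a point sent into `B` starts in the ball of
  -- radius `r` about `q`. This is the required set of finite intensity.
  obtain ⟨r, hr⟩ := hb.subset_ball 0
  have hvoid := IsPoissonProcess.measure_marked_void hY hΘ.measurable hΘ.uniform hΘ.indep
    hΘ.indep_points hC (S := Metric.ball q r) (fun z hz => by
      have h := hr hz
      rwa [mem_ball_zero_iff, LinearIsometry.norm_map, ← dist_eq_norm] at h)
    (smul_volume_ne_top Metric.isBounded_ball)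
  have hCB : ((lam • (volume : Measure Plane)).prod
      (cond (volume : Measure ℝ) (Set.Ico 0 (2 * Real.pi)))) C =
      (lam • (volume : Measure Plane)) B := by
    rw [Measure.prod_apply_symm hC]
    have hsec : ∀ θ, (lam • (volume : Measure Plane)) ((fun y => (y, θ)) ⁻¹' C) =
        (lam • (volume : Measure Plane)) B := fun θ => by
      have hmp : MeasurePreserving (fun y => frame θ (y - q)) (volume : Measure Plane) volume :=
        (measurePreserving_frame θ).comp (measurePreserving_sub_right volume q)
      rw [Measure.smul_apply, Measure.smul_apply, ← hmp.measure_preimage hB.nullMeasurableSet]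
      rfl
    simp_rw [hsec]
    rw [lintegral_const, measure_univ, mul_one]
  rw [hCB] at hvoid
  exact hvoid

end Laws

end Handover

/-! ### Comparison of the two networks -/

open Handover in
theorem theorem1
    -- density of the stations, common speed, time
    (lam : ℝ≥0) (hlam : 0 < lam) (v : ℝ) (hv : 0 ≤ v) (t : ℝ) (ht : 0 ≤ t)
    -- heights of the stations and initial positions of the UE in the two models
    (hB hD : ℝ) (p q : Handover.Plane)
    -- terrestrial model: static PPP, and a direction of the UE independent of it
    {Ω₁ : Type*} [MeasurableSpace Ω₁] (P₁ : Measure Ω₁) [IsProbabilityMeasure P₁]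
    (X : ℕ → Ω₁ → Handover.Plane) (hX : Handover.IsHomogeneousPPP X lam P₁)
    (Ψ : Ω₁ → ℝ) (hΨ : Measurable Ψ) (hΨX : IndepFun Ψ (fun ω i => X i ω) P₁)
    -- aerial model: PPP of initial positions, i.i.d. uniform directions independent of it
    {Ω₂ : Type*} [MeasurableSpace Ω₂] (P₂ : Measure Ω₂) [IsProbabilityMeasure P₂]
    (Y : ℕ → Ω₂ → Handover.Plane) (hY : Handover.IsHomogeneousPPP Y lam P₂)
    (Θ : ℕ → Ω₂ → ℝ) (hΘ : Handover.IsIIDUniformDirections Θ Y P₂) :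
    NullMeasurableSet (Handover.terrestrialHandover hB v p X Ψ t) P₁ ∧
    NullMeasurableSet (Handover.aerialHandover hD v q Y Θ t) P₂ ∧
    P₁ (Handover.terrestrialHandover hB v p X Ψ t) =
      P₂ (Handover.aerialHandover hD v q Y Θ t) := by
  let W₁ : Ω₁ → ℕ → Plane := fun ω i => frame (Ψ ω) (p - X i ω)
  let W₂ : Ω₂ → ℕ → Plane := fun ω i => frame (Θ i ω) (Y i ω - q)
  have hW₁ : Measurable W₁ := measurable_pi_lambda _ fun i =>
    measurable_frame_apply hΨ ((IsPoissonProcess.measurable hX i).const_sub p)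
  have hW₂ : Measurable W₂ := measurable_pi_lambda _ fun i =>
    measurable_frame_apply (hΘ.measurable i) ((IsPoissonProcess.measurable hY i).sub_const q)
  have hfin₁ : ∀ᵐ ω ∂P₁, FiniteInBalls (W₁ ω) := hX.ae_finiteInBalls p fun i ω => by
    rw [LinearIsometry.norm_map, dist_comm, dist_eq_norm]
  have hfin₂ : ∀ᵐ ω ∂P₂, FiniteInBalls (W₂ ω) := hY.ae_finiteInBalls q fun i ω => by
    rw [LinearIsometry.norm_map, dist_eq_norm]
  obtain ⟨A, hA, hAiff⟩ := exists_measurableSet_nearest_ne (0 : Plane) (t • (!₂[-v, 0] : Plane))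
  have hA' : MeasurableSet A := voidSigmaAlgebra_le A hA
  have hlaw : P₁ (W₁ ⁻¹' A) = P₂ (W₂ ⁻¹' A) := by
    have : IsProbabilityMeasure (P₁.map W₁) := Measure.isProbabilityMeasure_map hW₁.aemeasurable
    have : IsProbabilityMeasure (P₂.map W₂) := Measure.isProbabilityMeasure_map hW₂.aemeasurable
    rw [← Measure.map_apply hW₁ hA', ← Measure.map_apply hW₂ hA']
    refine measure_eq_of_voidEvent (fun B hB hb => ?_) hA
    rw [Measure.map_apply hW₁ (measurableSet_voidEvent hB),
      Measure.map_apply hW₂ (measurableSet_voidEvent hB)]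
    exact (hX.measure_void_frame_direction hΨ hΨX p hB hb).trans
      (hY.measure_void_frame_marks hΘ q hB hb).symm
  have hae₁ : terrestrialHandover hB v p X Ψ t =ᵐ[P₁] {ω | 0 < t ∧ ω ∈ W₁ ⁻¹' A} := by
    filter_upwards [hfin₁] with ω hω
    exact propext ((mem_terrestrialHandover_iff hω).trans (and_congr_right' (hAiff _ hω).symm))
  have hae₂ : aerialHandover hD v q Y Θ t =ᵐ[P₂] {ω | 0 < t ∧ ω ∈ W₂ ⁻¹' A} := by
    filter_upwards [hfin₂] with ω hω
    exact propext ((mem_aerialHandover_iff hω).trans (and_congr_right' (hAiff _ hω).symm))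
  refine ⟨NullMeasurableSet.congr ?_ hae₁.symm, NullMeasurableSet.congr ?_ hae₂.symm, ?_⟩
  · exact ((MeasurableSet.const _).inter (hW₁ hA')).nullMeasurableSet
  · exact ((MeasurableSet.const _).inter (hW₂ hA')).nullMeasurableSet
  · rw [measure_congr hae₁, measure_congr hae₂]
    -- At `t = 0` no earlier time exists and both probabilities vanish.
    by_cases h : 0 < t
    · simpa only [h, true_and, Set.ofPred_mem_eq] using hlaw
    · simp [h]
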